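/- Let $k$ be a field and let $G$ be a group with infinitely many conjugacy classes. A right $kG$-comodule is a $k$-vector space $V$ with a coassociative, counital coaction $v\mapsto v_0\otimes v_1\in V\otimes kG$; with the diagonal coaction on tensor products these form a monoidal category $\mathcal M^{kG}$, whose morphism spaces are written $\mathrm{Hom}(-,-)^G$. A symmetric $2$-contratrace on a monoidal category $\mathcal C$ is a contravariant functor $\mathcal F$ from $\mathcal C$ to $k$-vector spaces with natural isomorphisms $\iota_{X,Y}:\mathcal F(X\otimes Y)\to\mathcal F(Y\otimes X)$ such that (suppressing associativity and unit isomorphisms) $\iota_{T,U\otimes V}=\iota_{V\otimes T,U}\circ\iota_{T\otimes U,V}$, $\iota_{X,1}=\mathrm{id}$, $\iota_{1,X}=\mathrm{id}$ and $\iota_{Y,X}\circ\iota_{X,Y}=\mathrm{id}$. It is left exact if, as a functor on $\mathcal C^{op}$, it preserves finite limits. A stable anti-Yetter-Drinfeld (saYD) module over a Hopf algebra $H$ with antipode $S$ is a left $H$-module and right $H$-comodule $M$ with $(hm)_0\otimes(hm)_1=h^2m_0\otimes h^3m_1S(h^1)$ and $m_1m_0=m$, where $h^1\otimes h^2\otimes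 h^3$ is the iterated coproduct of $h$. Let $\mathrm{Vec}'_{G/G}$ be the collection of $G$-graded vector spaces $\mathcal M=(\mathcal M_g)_{g\in G}$ with a $G$-action by linear maps $x:\mathcal M_g\to\mathcal M_{xgx^{-1}}$ such that $x$ acts as the identity on $\mathcal M_x$ for all $x\in G$. For such $\mathcal M$ let $\Gamma_c(G,\mathcal M)=\bigoplus_{g\in G}\mathcal M_g$, an saYD-module over $kG$ with coaction $m\mapsto m\otimes g$ for $m\in\mathcal M_g$ and the given $G$-action. For each conjugacy class $\langle g\rangle$ of $G$ let $\mathcal M_{\langle g\rangle}\in\mathrm{Vec}'_{G/G}$ have support exactly $\langle g\rangle$, that is, $(\mathcal M_{\langle g\rangle})_x\neq0$ if and only if $x\in\langle g\rangle$; for example $(\mathcal M_{\langle g\rangle})_x=k$ for $x\in\langle g\rangle$ and $0$ otherwise, with the trivial $G$-action, has this property. Put $\mathcal F_{\langle g\rangle}(V)=\mathrm{Hom}(V,\Gamma_c(G,\mathcal M_{\langle g\rangle}))^G$. Then: 1. Each $\mathcal F_{\langle g\rangle}$ is a left exact symmetric $2$-contratrace on $\mathcal M^{kG}$, with $\iota_{V,W}(f)(w\otimes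 v)=w_1f(v\otimes w_0)$. 2. The functor $\bigoplus_{\langle g\rangle}\mathcal F_{\langle g\rangle}:V\mapsto\bigoplus_{\langle g\rangle}\mathcal F_{\langle g\rangle}(V)$, with the direct sum of these symmetries, is a left exact symmetric $2$-contratrace on $\mathcal M^{kG}$. 3. The functor $\bigoplus_{\langle g\rangle}\mathcal F_{\langle g\rangle}$ is not representable, even as a functor to sets. In particular it is not isomorphic to $\mathrm{Hom}(-,N)^G$ for any saYD-module $N$ over $kG$. -/

import Mathlib

open CategoryTheory MonoidalCategory Opposite TensorProduct
open scoped DirectSum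

universe u

/-! ## Right comodules over a coalgebra -/

/-- A right comodule `(V, ρ)`, `ρ : V → V ⊗ H`, over a coalgebra `H`: the coaction is
coassociative and counital. -/
structure Comodule (k H : Type u) [CommRing k] [AddCommGroup H] [Module k H]
    [Coalgebra k H] where
  carrier : Type u
  [addCommGroup : AddCommGroup carrier]
  [module : Module k carrier]
  coact : carrier →ₗ[k] carrier ⊗[k] H
  coassoc : (TensorProduct.assoc k carrier H H).toLinearMap ∘ₗ coact.rTensor H ∘ₗ coact =
    (Coalgebra.comul (R := k) (A := H)).lTensor carrier ∘ₗ coact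
  counital : (TensorProduct.rid k carrier).toLinearMap ∘ₗ
    (Coalgebra.counit (R := k) (A := H)).lTensor carrier ∘ₗ coact = LinearMap.id

attribute [instance] Comodule.addCommGroup Comodule.module

namespace Comodule

noncomputable section

section Coalg

variable {k H : Type u} [CommRing k] [AddCommGroup H] [Module k H] [Coalgebra k H]

/-- Morphisms of comodules: linear maps commuting with the coactions. -/
@[ext]
structure Hom (V W : Comodule k H) where
  toLinearMap : V.carrier →ₗ[k] W.carrier
  comm : toLinearMap.rTensor H ∘ₗ V.coact = W.coact ∘ₗ toLinearMap

instance : Category (Comodule k H) where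
  Hom V W := Hom V W
  id V := ⟨LinearMap.id, by simp⟩
  comp f g := ⟨g.toLinearMap ∘ₗ f.toLinearMap, by
    rw [LinearMap.rTensor_comp, LinearMap.comp_assoc, f.comm, ← LinearMap.comp_assoc, g.comm,
      LinearMap.comp_assoc]⟩

/-- The linear map underlying a morphism of comodules. -/
def lin {V W : Comodule k H} (f : V ⟶ W) : V.carrier →ₗ[k] W.carrier := Hom.toLinearMap f

theorem lin_injective {V W : Comodule k H} :
    Function.Injective (lin : (V ⟶ W) → (V.carrier →ₗ[k] W.carrier)) :=
  fun f g h => Hom.ext (x := f) (y := g) h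

@[ext]
theorem hom_ext {V W : Comodule k H} {f g : V ⟶ W} (h : lin f = lin g) : f = g :=
  lin_injective h

theorem lin_comm {V W : Comodule k H} (f : V ⟶ W) :
    (lin f).rTensor H ∘ₗ V.coact = W.coact ∘ₗ lin f := Hom.comm f

/-- Constructor for morphisms of comodules. -/
def mkHom {V W : Comodule k H} (f : V.carrier →ₗ[k] W.carrier)
    (h : f.rTensor H ∘ₗ V.coact = W.coact ∘ₗ f) : V ⟶ W := Hom.mk f h

@[simp] theorem lin_mkHom {V W : Comodule k H} (f : V.carrier →ₗ[k] W.carrier)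
    (h : f.rTensor H ∘ₗ V.coact = W.coact ∘ₗ f) : lin (mkHom f h) = f := rfl

@[simp] theorem lin_id (V : Comodule k H) : lin (𝟙 V) = LinearMap.id := rfl

@[simp] theorem lin_comp {U V W : Comodule k H} (f : U ⟶ V) (g : V ⟶ W) :
    lin (f ≫ g) = lin g ∘ₗ lin f := rfl

/-! The vector space structure on `Hom(V, W)^H`. -/


/-- The subspace of linear maps `V → W` that are morphisms of comodules. -/
def homSubmodule (V W : Comodule k H) : Submodule k (V.carrier →ₗ[k] W.carrier) where
  carrier := {f | f.rTensor H ∘ₗ V.coact = W.coact ∘ₗ f}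
  add_mem' {f g} hf hg := by
    simp only [Set.mem_ofPred_eq] at hf hg ⊢
    rw [LinearMap.rTensor_add, LinearMap.add_comp, hf, hg, LinearMap.comp_add]
  zero_mem' := by simp
  smul_mem' c f hf := by
    simp only [Set.mem_ofPred_eq] at hf ⊢
    rw [LinearMap.rTensor_smul, LinearMap.smul_comp, hf, LinearMap.comp_smul]

/-- Morphisms of comodules, as elements of a subspace of the space of linear maps. -/
def homEquiv (V W : Comodule k H) : (V ⟶ W) ≃ homSubmodule V W where
  toFun f := ⟨lin f, lin_comm f⟩
  invFun f := mkHom f.1 f.2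
  left_inv _ := rfl
  right_inv _ := rfl

instance (V W : Comodule k H) : AddCommGroup (V ⟶ W) := (homEquiv V W).addCommGroup

instance (V W : Comodule k H) : Module k (V ⟶ W) := (homEquiv V W).module k

@[simp] theorem lin_add {V W : Comodule k H} (f g : V ⟶ W) : lin (f + g) = lin f + lin g := rfl

@[simp] theorem lin_smul {V W : Comodule k H} (c : k) (f : V ⟶ W) :
    lin (c • f) = c • lin f := rfl

instance : Preadditive (Comodule k H) where
  add_comp _ _ _ f f' g := hom_ext (by simp [LinearMap.comp_add])
  comp_add _ _ _ f g g' := hom_ext (by simp [LinearMap.add_comp])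

instance : Linear k (Comodule k H) where
  smul_comp _ _ _ r f g := hom_ext (by simp [LinearMap.comp_smul])
  comp_smul _ _ _ f r g := hom_ext (by simp [LinearMap.smul_comp])

/-- An invertible linear map that commutes with the coactions is an isomorphism. -/
def mkIso {V W : Comodule k H} (e : V.carrier ≃ₗ[k] W.carrier)
    (h : e.toLinearMap.rTensor H ∘ₗ V.coact = W.coact ∘ₗ e.toLinearMap) : V ≅ W where
  hom := mkHom e.toLinearMap h
  inv := mkHom e.symm.toLinearMap (by
    have h1 : e.symm.toLinearMap.rTensor H ∘ₗ e.toLinearMap.rTensor H = LinearMap.id := by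
      rw [← LinearMap.rTensor_comp]; simp
    have h2 : e.toLinearMap ∘ₗ e.symm.toLinearMap = LinearMap.id := by simp
    calc e.symm.toLinearMap.rTensor H ∘ₗ W.coact
        = e.symm.toLinearMap.rTensor H ∘ₗ (W.coact ∘ₗ e.toLinearMap) ∘ₗ e.symm.toLinearMap := by
          rw [LinearMap.comp_assoc, h2, LinearMap.comp_id]
      _ = V.coact ∘ₗ e.symm.toLinearMap := by
          rw [← h, ← LinearMap.comp_assoc, ← LinearMap.comp_assoc, h1, LinearMap.id_comp])
  hom_inv_id := hom_ext (by ext; simp)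
  inv_hom_id := hom_ext (by ext; simp)

/-- The forgetful functor to vector spaces. -/
def forgetful : Comodule k H ⥤ ModuleCat.{u} k where
  obj V := ModuleCat.of k V.carrier
  map f := ModuleCat.ofHom (lin f)

instance : (forgetful (k := k) (H := H)).Faithful where
  map_injective h := hom_ext (congrArg ModuleCat.Hom.hom h)

end Coalg

/-! ## The tensor product of comodules over a bialgebra -/

section Bialg

variable {k H : Type u} [CommRing k] [Ring H] [Bialgebra k H]

/-- `(v ⊗ a) ⊗ (w ⊗ b) ↦ (v ⊗ w) ⊗ ab`. -/
def mulMap (k : Type u) [CommRing k] (A V W : Type u) [Ring A] [Algebra k A] [AddCommGroup V]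
    [Module k V] [AddCommGroup W] [Module k W] :
    (V ⊗[k] A) ⊗[k] (W ⊗[k] A) →ₗ[k] (V ⊗[k] W) ⊗[k] A :=
  (LinearMap.mul' k A).lTensor (V ⊗[k] W) ∘ₗ
    (TensorProduct.tensorTensorTensorComm k V A W A).toLinearMap

@[simp] theorem mulMap_tmul (A V W : Type u) [Ring A] [Algebra k A] [AddCommGroup V]
    [Module k V] [AddCommGroup W] [Module k W] (v : V) (a : A) (w : W) (b : A) :
    mulMap k A V W ((v ⊗ₜ a) ⊗ₜ (w ⊗ₜ b)) = (v ⊗ₜ w) ⊗ₜ (a * b) := by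
  simp [mulMap]

/-- The diagonal coaction `v ⊗ w ↦ (v₀ ⊗ w₀) ⊗ v₁ w₁`. -/
def tensorCoact (V W : Comodule k H) :
    V.carrier ⊗[k] W.carrier →ₗ[k] (V.carrier ⊗[k] W.carrier) ⊗[k] H :=
  mulMap k H V.carrier W.carrier ∘ₗ TensorProduct.map V.coact W.coact

@[simp] theorem tensorCoact_tmul (V W : Comodule k H) (v : V.carrier) (w : W.carrier) :
    tensorCoact V W (v ⊗ₜ w) = mulMap k H V.carrier W.carrier (V.coact v ⊗ₜ W.coact w) := by
  simp [tensorCoact]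

theorem lTensor_comul_mulMap (V W : Type u) [AddCommGroup V]
    [Module k V] [AddCommGroup W] [Module k W] (x : V ⊗[k] H) (y : W ⊗[k] H) :
    (Coalgebra.comul (R := k) (A := H)).lTensor (V ⊗[k] W) (mulMap k H V W (x ⊗ₜ y)) =
      mulMap k (H ⊗[k] H) V W ((Coalgebra.comul (R := k) (A := H)).lTensor V x ⊗ₜ
        (Coalgebra.comul (R := k) (A := H)).lTensor W y) := by
  induction x with
  | zero => simp
  | add x x' hx hx' => simp only [TensorProduct.add_tmul, map_add, hx, hx']
  | tmul v a =>
    induction y with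
    | zero => simp
    | add y y' hy hy' => simp only [TensorProduct.tmul_add, map_add, hy, hy']
    | tmul w b => simp

theorem lTensor_counit_mulMap (V W : Type u) [AddCommGroup V]
    [Module k V] [AddCommGroup W] [Module k W] (x : V ⊗[k] H) (y : W ⊗[k] H) :
    (Coalgebra.counit (R := k) (A := H)).lTensor (V ⊗[k] W) (mulMap k H V W (x ⊗ₜ y)) =
      mulMap k k V W ((Coalgebra.counit (R := k) (A := H)).lTensor V x ⊗ₜ
        (Coalgebra.counit (R := k) (A := H)).lTensor W y) := by
  induction x with
  | zero => simp
  | add x x' hx hx' => simp only [TensorProduct.add_tmul, map_add, hx, hx']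
  | tmul v a =>
    induction y with
    | zero => simp
    | add y y' hy hy' => simp only [TensorProduct.tmul_add, map_add, hy, hy']
    | tmul w b => simp

theorem rid_mulMap (V W : Type u) [AddCommGroup V]
    [Module k V] [AddCommGroup W] [Module k W] (x : V ⊗[k] k) (y : W ⊗[k] k) :
    TensorProduct.rid k (V ⊗[k] W) (mulMap k k V W (x ⊗ₜ y)) =
      TensorProduct.rid k V x ⊗ₜ TensorProduct.rid k W y := by
  induction x with
  | zero => simp
  | add x x' hx hx' => simp only [TensorProduct.add_tmul, map_add, hx, hx']
  | tmul v a =>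
    induction y with
    | zero => simp
    | add y y' hy hy' => simp only [TensorProduct.tmul_add, map_add, hy, hy']
    | tmul w b => 
      simp only [mulMap_tmul, TensorProduct.rid_tmul, TensorProduct.smul_tmul',
        TensorProduct.tmul_smul, mul_smul]
      rw [smul_comm]

theorem assoc_mulMap (V W : Type u) [AddCommGroup V] [Module k V] [AddCommGroup W]
    [Module k W] (x : V ⊗[k] H) (y : W ⊗[k] H) (a b : H) :
    TensorProduct.assoc k (V ⊗[k] W) H H (mulMap k H V W (x ⊗ₜ y) ⊗ₜ (a * b)) =
      mulMap k (H ⊗[k] H) V W (TensorProduct.assoc k V H H (x ⊗ₜ a) ⊗ₜ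
        TensorProduct.assoc k W H H (y ⊗ₜ b)) := by
  induction x with
  | zero => simp
  | add x x' hx hx' => simp only [TensorProduct.add_tmul, map_add, hx, hx']
  | tmul v c =>
    induction y with
    | zero => simp
    | add y y' hy hy' => simp only [TensorProduct.tmul_add, TensorProduct.add_tmul, map_add, hy, hy']
    | tmul w d => simp

theorem assoc_rTensor_tensorCoact (V W : Comodule k H) (x : V.carrier ⊗[k] H)
    (y : W.carrier ⊗[k] H) :
    TensorProduct.assoc k (V.carrier ⊗[k] W.carrier) H H
      ((tensorCoact V W).rTensor H (mulMap k H V.carrier W.carrier (x ⊗ₜ y))) =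
    mulMap k (H ⊗[k] H) V.carrier W.carrier
      (TensorProduct.assoc k V.carrier H H (V.coact.rTensor H x) ⊗ₜ
        TensorProduct.assoc k W.carrier H H (W.coact.rTensor H y)) := by
  induction x with
  | zero => simp
  | add x x' hx hx' => simp only [TensorProduct.add_tmul, map_add, hx, hx']
  | tmul v a =>
    induction y with
    | zero => simp
    | add y y' hy hy' => simp only [TensorProduct.tmul_add, map_add, hy, hy']
    | tmul w b => simp [assoc_mulMap]

theorem coassoc_apply (V : Comodule k H) (v : V.carrier) :
    TensorProduct.assoc k V.carrier H H (V.coact.rTensor H (V.coact v)) =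
      (Coalgebra.comul (R := k) (A := H)).lTensor V.carrier (V.coact v) :=
  LinearMap.congr_fun V.coassoc v

theorem counital_apply (V : Comodule k H) (v : V.carrier) :
    TensorProduct.rid k V.carrier
      ((Coalgebra.counit (R := k) (A := H)).lTensor V.carrier (V.coact v)) = v :=
  LinearMap.congr_fun V.counital v

/-- The tensor product of comodules, with the diagonal coaction. -/
def tensor (V W : Comodule k H) : Comodule k H where
  carrier := V.carrier ⊗[k] W.carrier
  coact := tensorCoact V W
  coassoc := by
    ext v w
    simp [assoc_rTensor_tensorCoact, lTensor_comul_mulMap, coassoc_apply]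
  counital := by
    ext v w
    simp only [AlgebraTensorModule.curry_apply, LinearMap.restrictScalars_self, curry_apply,
      LinearMap.coe_comp, LinearEquiv.coe_coe, Function.comp_apply, tensorCoact_tmul,
      lTensor_counit_mulMap, rid_mulMap, counital_apply, LinearMap.id_coe, id_eq]

/-- The trivial one-dimensional comodule `k`, `1 ↦ 1 ⊗ 1`. -/
def unit (k H : Type u) [CommRing k] [Ring H] [Bialgebra k H] : Comodule k H where
  carrier := k
  coact := (TensorProduct.mk k k H).flip 1
  coassoc := by ext; simp [Algebra.TensorProduct.one_def]
  counital := by ext; simp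

theorem rTensor_mulMap {V V' W W' : Type u} [AddCommGroup V] [Module k V] [AddCommGroup W]
    [Module k W] [AddCommGroup V'] [Module k V'] [AddCommGroup W'] [Module k W']
    (f : V →ₗ[k] V') (g : W →ₗ[k] W') (x : V ⊗[k] H) (y : W ⊗[k] H) :
    (TensorProduct.map f g).rTensor H (mulMap k H V W (x ⊗ₜ y)) =
      mulMap k H V' W' (f.rTensor H x ⊗ₜ g.rTensor H y) := by
  induction x with
  | zero => simp
  | add x x' hx hx' => simp only [TensorProduct.add_tmul, map_add, hx, hx']
  | tmul v a =>
    induction y with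
    | zero => simp
    | add y y' hy hy' => simp only [TensorProduct.tmul_add, map_add, hy, hy']
    | tmul w b => simp

/-- The tensor product of two morphisms of comodules. -/
def tensorMap {V V' W W' : Comodule k H} (f : V ⟶ V') (g : W ⟶ W') :
    tensor V W ⟶ tensor V' W' :=
  mkHom (V := tensor V W) (W := tensor V' W') (TensorProduct.map (lin f) (lin g)) (by
    have hf (v) : (lin f).rTensor H (V.coact v) = V'.coact (lin f v) :=
      LinearMap.congr_fun (lin_comm f) v
    have hg (w) : (lin g).rTensor H (W.coact w) = W'.coact (lin g w) :=
      LinearMap.congr_fun (lin_comm g) w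
    apply TensorProduct.ext'
    intro v w
    change (TensorProduct.map (lin f) (lin g)).rTensor H (tensorCoact V W (v ⊗ₜ w)) =
      tensorCoact V' W' (lin f v ⊗ₜ lin g w)
    simp [rTensor_mulMap, hf, hg])

theorem rTensor_assoc_mulMap {U V W : Type u} [AddCommGroup U] [Module k U] [AddCommGroup V]
    [Module k V] [AddCommGroup W] [Module k W] (x : U ⊗[k] H) (y : V ⊗[k] H) (z : W ⊗[k] H) :
    (TensorProduct.assoc k U V W).toLinearMap.rTensor H
      (mulMap k H (U ⊗[k] V) W (mulMap k H U V (x ⊗ₜ y) ⊗ₜ z)) =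
    mulMap k H U (V ⊗[k] W) (x ⊗ₜ mulMap k H V W (y ⊗ₜ z)) := by
  induction x with
  | zero => simp
  | add x x' hx hx' => simp only [TensorProduct.add_tmul, map_add, hx, hx']
  | tmul u a =>
    induction y with
    | zero => simp
    | add y y' hy hy' =>
      simp only [TensorProduct.tmul_add, TensorProduct.add_tmul, map_add, hy, hy']
    | tmul v b =>
      induction z with
      | zero => simp
      | add z z' hz hz' => simp only [TensorProduct.tmul_add, map_add, hz, hz']
      | tmul w c => simp [mul_assoc]

/-- `(U ⊗ V) ⊗ W ≅ U ⊗ (V ⊗ W)`, the associator of vector spaces. -/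
def assocIso (U V W : Comodule k H) : tensor (tensor U V) W ≅ tensor U (tensor V W) :=
  mkIso (V := tensor (tensor U V) W) (W := tensor U (tensor V W))
    (TensorProduct.assoc k U.carrier V.carrier W.carrier) (by
      apply TensorProduct.ext_threefold
      intro u v w
      change (TensorProduct.assoc k U.carrier V.carrier W.carrier).toLinearMap.rTensor H
        (mulMap k H (U.carrier ⊗[k] V.carrier) W.carrier
          (tensorCoact U V (u ⊗ₜ v) ⊗ₜ W.coact w)) =
        mulMap k H U.carrier (V.carrier ⊗[k] W.carrier)
          (U.coact u ⊗ₜ tensorCoact V W (v ⊗ₜ w))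
      rw [tensorCoact_tmul, tensorCoact_tmul, rTensor_assoc_mulMap])

theorem rTensor_lid_mulMap {V : Type u} [AddCommGroup V] [Module k V] (r : k) (x : V ⊗[k] H) :
    (TensorProduct.lid k V).toLinearMap.rTensor H (mulMap k H k V ((r ⊗ₜ 1) ⊗ₜ x)) = r • x := by
  induction x with
  | zero => simp
  | add x x' hx hx' => simp only [TensorProduct.tmul_add, map_add, hx, hx', smul_add]
  | tmul v a => simp [TensorProduct.smul_tmul']

theorem rTensor_rid_mulMap {V : Type u} [AddCommGroup V] [Module k V] (r : k) (x : V ⊗[k] H) :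
    (TensorProduct.rid k V).toLinearMap.rTensor H (mulMap k H V k (x ⊗ₜ (r ⊗ₜ 1))) = r • x := by
  induction x with
  | zero => simp
  | add x x' hx hx' => simp only [TensorProduct.add_tmul, map_add, hx, hx', smul_add]
  | tmul v a => simp [TensorProduct.smul_tmul']

/-- `k ⊗ V ≅ V`. -/
def leftUnitIso (V : Comodule k H) : tensor (unit k H) V ≅ V :=
  mkIso (V := tensor (unit k H) V) (TensorProduct.lid k V.carrier) (by
    apply TensorProduct.ext'
    intro (r : k) v
    change (TensorProduct.lid k V.carrier).toLinearMap.rTensor H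
      (mulMap k H k V.carrier ((r ⊗ₜ 1) ⊗ₜ V.coact v)) =
      V.coact (TensorProduct.lid k V.carrier (r ⊗ₜ v))
    rw [rTensor_lid_mulMap, TensorProduct.lid_tmul, map_smul])

/-- `V ⊗ k ≅ V`. -/
def rightUnitIso (V : Comodule k H) : tensor V (unit k H) ≅ V :=
  mkIso (V := tensor V (unit k H)) (TensorProduct.rid k V.carrier) (by
    apply TensorProduct.ext'
    intro v (r : k)
    change (TensorProduct.rid k V.carrier).toLinearMap.rTensor H
      (mulMap k H V.carrier k (V.coact v ⊗ₜ (r ⊗ₜ 1))) =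
      V.coact (TensorProduct.rid k V.carrier (v ⊗ₜ r))
    rw [rTensor_rid_mulMap, TensorProduct.rid_tmul, map_smul])

instance : MonoidalCategoryStruct (Comodule k H) where
  tensorObj := tensor
  whiskerLeft V _ _ g := tensorMap (𝟙 V) g
  whiskerRight f W := tensorMap f (𝟙 W)
  tensorHom := tensorMap
  tensorUnit := unit k H
  associator := assocIso
  leftUnitor := leftUnitIso
  rightUnitor := rightUnitIso

/-- The monoidal category of `H`-comodules; its structure lies over that of vector spaces. -/
instance : MonoidalCategory (Comodule k H) :=
  Monoidal.induced forgetful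
    { μIso := fun V W => Iso.refl (ModuleCat.of k (V.carrier ⊗[k] W.carrier))
      εIso := Iso.refl (ModuleCat.of k k)
      whiskerLeft_eq := fun V W W' g => by
        apply ModuleCat.hom_ext
        apply TensorProduct.ext'
        intro v w
        rfl
      whiskerRight_eq := fun f W => by
        apply ModuleCat.hom_ext
        apply TensorProduct.ext'
        intro v w
        rfl
      tensorHom_eq := fun f g => by
        apply ModuleCat.hom_ext
        apply TensorProduct.ext'
        intro v w
        rfl
      associator_eq := fun U V W => by
        apply ModuleCat.hom_ext
        apply TensorProduct.ext_threefold
        intro u v w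
        rfl
      leftUnitor_eq := fun V => by
        apply ModuleCat.hom_ext
        apply TensorProduct.ext'
        intro r v
        rfl
      rightUnitor_eq := fun V => by
        apply ModuleCat.hom_ext
        apply TensorProduct.ext'
        intro v r
        rfl }

end Bialg

end

end Comodule

/-! ## Symmetric 2-contratraces -/

section Contratrace

variable (k : Type u) [CommRing k] {C : Type*} [Category.{u} C] [MonoidalCategory C]

/-- The structure of a symmetric 2-contratrace on a contravariant functor `F` from a monoidal
category to vector spaces: natural isomorphisms `ι : F(X ⊗ Y) ≅ F(Y ⊗ X)` that exhibit `F` as a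
central element of the bimodule category of contravariant functors (`hexagon`, `unit`), and that
are symmetric (`stable`, and, equivalently in the presence of `hexagon`, `symmetric`). -/
structure SymmetricTwoContratrace (F : Cᵒᵖ ⥤ ModuleCat.{u} k) where
  ι : ∀ X Y : C, F.obj (op (X ⊗ Y)) ≅ F.obj (op (Y ⊗ X))
  natural : ∀ {X X' Y Y' : C} (f : X ⟶ X') (g : Y ⟶ Y'),
    F.map (f ⊗ₘ g).op ≫ (ι X Y).hom = (ι X' Y').hom ≫ F.map (g ⊗ₘ f).op
  /-- `F(T ⊗ (U ⊗ V)) → F((U ⊗ V) ⊗ T)` is the composite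
  `F((T ⊗ U) ⊗ V) → F(V ⊗ (T ⊗ U)) = F((V ⊗ T) ⊗ U) → F(U ⊗ (V ⊗ T))`. -/
  hexagon : ∀ T U V : C,
    (ι T (U ⊗ V)).hom =
      F.map (α_ T U V).hom.op ≫ (ι (T ⊗ U) V).hom ≫ F.map (α_ V T U).hom.op ≫
        (ι (V ⊗ T) U).hom ≫ F.map (α_ U V T).hom.op
  unit : ∀ X : C, (ι X (𝟙_ C)).hom = F.map (ρ_ X).inv.op ≫ F.map (λ_ X).hom.op
  stable : ∀ X : C, (ι (𝟙_ C) X).hom = F.map (λ_ X).inv.op ≫ F.map (ρ_ X).hom.op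
  symmetric : ∀ X Y : C, (ι X Y).hom ≫ (ι Y X).hom = 𝟙 _

/-- The pointwise direct sum `X ↦ ⨁ i, F i X`. -/
noncomputable def directSumFunctor {I : Type u} (F : I → Cᵒᵖ ⥤ ModuleCat.{u} k) :
    Cᵒᵖ ⥤ ModuleCat.{u} k where
  obj X := ModuleCat.of k (⨁ i, (F i).obj X)
  map f := ModuleCat.ofHom (DirectSum.lmap fun i => ((F i).map f).hom)
  map_id X := by
    apply ModuleCat.hom_ext
    apply LinearMap.ext
    intro t
    apply DFinsupp.ext
    intro i
    simp
  map_comp f g := by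
    apply ModuleCat.hom_ext
    apply LinearMap.ext
    intro t
    apply DFinsupp.ext
    intro i
    simp [DirectSum.lmap_apply]

/-- The projection of the direct sum to its `i`-th component. -/
noncomputable def directSumProj {I : Type u} (F : I → Cᵒᵖ ⥤ ModuleCat.{u} k) (i : I) :
    directSumFunctor k F ⟶ F i where
  app X := ModuleCat.ofHom (DirectSum.component k I (fun j => (F j).obj X) i)
  naturality X Y f := by
    apply ModuleCat.hom_ext
    apply LinearMap.ext
    intro t
    rfl

end Contratrace

/-! ## Stable anti-Yetter-Drinfeld modules -/

noncomputable section SAYD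

/-- For a linear action `act` of `H` on `V`, the map
`a ⊗ (b ⊗ c) ↦ (v ⊗ h ↦ b v ⊗ c h S(a))`. -/
def aydMap {k H V : Type u} [CommRing k] [Ring H] [HopfAlgebra k H] [AddCommGroup V] [Module k V]
    (act : H →ₗ[k] Module.End k V) :
    H ⊗[k] (H ⊗[k] H) →ₗ[k] V ⊗[k] H →ₗ[k] V ⊗[k] H :=
  TensorProduct.lift <| LinearMap.mk₂ k
    (fun a y => TensorProduct.homTensorHomMap (RingHom.id k) V H V H
        (TensorProduct.map act (LinearMap.mul k H) y) ∘ₗ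
      (LinearMap.mulRight k (HopfAlgebra.antipode k a)).lTensor V)
    (fun a a' y => by
      apply TensorProduct.ext'
      intro v h
      simp [mul_add, TensorProduct.tmul_add])
    (fun c a y => by
      apply TensorProduct.ext'
      intro v h
      simp)
    (fun a y y' => by
      apply TensorProduct.ext'
      intro v h
      simp)
    (fun c a y => by
      apply TensorProduct.ext'
      intro v h
      simp)

@[simp] theorem aydMap_tmul {k H V : Type u} [CommRing k] [Ring H] [HopfAlgebra k H]
    [AddCommGroup V] [Module k V] (act : H →ₗ[k] Module.End k V) (a b c : H) (v : V) (h : H) :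
    aydMap act (a ⊗ₜ (b ⊗ₜ c)) (v ⊗ₜ h) = act b v ⊗ₜ (c * (h * HopfAlgebra.antipode k a)) := by
  simp [aydMap]

/-- A stable (left-right) anti-Yetter-Drinfeld module: a left `H`-module and right `H`-comodule
with `(hm)₀ ⊗ (hm)₁ = h² m₀ ⊗ h³ m₁ S(h¹)` and `m₁ m₀ = m`. -/
structure SAYDModule (k H : Type u) [CommRing k] [Ring H] [HopfAlgebra k H] extends
    Comodule k H where
  act : H →ₐ[k] Module.End k carrier
  compat : ∀ (h : H) (m : carrier),
    coact (act h m) = aydMap act.toLinearMap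
      ((Coalgebra.comul (R := k) (A := H)).lTensor H (Coalgebra.comul (R := k) h)) (coact m)
  stable : ∀ m : carrier, TensorProduct.lift act.toLinearMap.flip (coact m) = m

namespace SAYDModule

variable {k H : Type u} [CommRing k] [Ring H] [HopfAlgebra k H]

/-- The representable functor `V ↦ Hom(V, M)^H`. -/
def homFunctor (M : SAYDModule k H) : (Comodule k H)ᵒᵖ ⥤ ModuleCat.{u} k :=
  (linearYoneda k (Comodule k H)).obj M.toComodule

/-- The map `Hom(V ⊗ W, M) → Hom(W ⊗ V, M)`, `f ↦ (w ⊗ v ↦ w₁ f(v ⊗ w₀))`. -/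
def twist (M : SAYDModule k H) (V W : Comodule k H)
    (f : V.carrier ⊗[k] W.carrier →ₗ[k] M.carrier) :
    W.carrier ⊗[k] V.carrier →ₗ[k] M.carrier :=
  TensorProduct.lift (TensorProduct.lift (LinearMap.mk₂ k
      (fun (w : W.carrier) (h : H) => M.act h ∘ₗ f ∘ₗ (TensorProduct.mk k _ _).flip w)
      (fun w w' h => by ext; simp)
      (fun c w h => by ext; simp)
      (fun w h h' => by ext; simp)
      (fun c w h => by ext; simp))) ∘ₗ W.coact.rTensor V.carrier

/-- The symmetry `Hom(V ⊗ W, M)^H → Hom(W ⊗ V, M)^H` of a symmetric 2-contratrace structure on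
`Hom(-, M)^H` is the one given by the action of `H` on `M`. -/
def IsCanonicalSymmetry (M : SAYDModule k H) (τ : SymmetricTwoContratrace k M.homFunctor) : Prop :=
  ∀ (V W : Comodule k H) (f : V ⊗ W ⟶ M.toComodule),
    Comodule.lin (V := W ⊗ V) (W := M.toComodule) ((τ.ι V W).hom.hom f) =
      M.twist V W (Comodule.lin f)

end SAYDModule

end SAYD

/-! ## Stable `G`-equivariant `G`-graded vector spaces -/

/-- A `G`-equivariant `G`-graded vector space: spaces `M_g` and a `G`-action by maps
`x : M_g → M_{xgx⁻¹}`, stable in the sense that `x` acts as the identity on `M_x`. -/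
structure StableEquivariantGraded (k G : Type u) [Field k] [Group G] where
  fiber : G → Type u
  [addCommGroup : ∀ g, AddCommGroup (fiber g)]
  [module : ∀ g, Module k (fiber g)]
  act : ∀ (x : G) {g h : G}, x * g * x⁻¹ = h → (fiber g →ₗ[k] fiber h)
  act_one : ∀ {g : G} (e : 1 * g * 1⁻¹ = g) (m : fiber g), act 1 e m = m
  act_mul : ∀ (x y : G) {g h l : G} (ey : y * g * y⁻¹ = h) (ex : x * h * x⁻¹ = l)
    (exy : x * y * g * (x * y)⁻¹ = l) (m : fiber g), act x ex (act y ey m) = act (x * y) exy m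
  stable : ∀ (x : G) (e : x * x * x⁻¹ = x) (m : fiber x), act x e m = m

attribute [instance] StableEquivariantGraded.addCommGroup StableEquivariantGraded.module

namespace StableEquivariantGraded

noncomputable section

variable {k G : Type u} [Field k] [Group G]

/-- The set of `g` with `M_g ≠ 0`. -/
def support (M : StableEquivariantGraded k G) : Set G := {g | Nontrivial (M.fiber g)}

open Classical in
/-- The coaction `m ↦ m ⊗ g`, `m ∈ M_g`, on `⨁ g, M_g`. -/
def coact (M : StableEquivariantGraded k G) :
    (⨁ g, M.fiber g) →ₗ[k] (⨁ g, M.fiber g) ⊗[k] MonoidAlgebra k G :=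
  DirectSum.toModule k G _ fun g =>
    (TensorProduct.mk k _ _).flip (MonoidAlgebra.of k G g) ∘ₗ DirectSum.lof k G M.fiber g

open Classical in
theorem coact_lof (M : StableEquivariantGraded k G) (g : G) (m : M.fiber g) :
    M.coact (DirectSum.lof k G M.fiber g m) =
      DirectSum.lof k G M.fiber g m ⊗ₜ MonoidAlgebra.of k G g := by
  rw [coact, DirectSum.toModule_lof]
  rfl

open Classical in
/-- The action of `x : G` on `⨁ g, M_g`. -/
def actionMap (M : StableEquivariantGraded k G) (x : G) : Module.End k (⨁ g, M.fiber g) :=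
  DirectSum.toModule k G _ fun g =>
    DirectSum.lof k G M.fiber (x * g * x⁻¹) ∘ₗ M.act x rfl

open Classical in
theorem actionMap_lof (M : StableEquivariantGraded k G) (x : G) {g h : G} (e : x * g * x⁻¹ = h)
    (m : M.fiber g) :
    M.actionMap x (DirectSum.lof k G M.fiber g m) = DirectSum.lof k G M.fiber h (M.act x e m) := by
  subst e
  rw [actionMap, DirectSum.toModule_lof]
  rfl

/-- The action of `G` on `⨁ g, M_g`. -/
def rep (M : StableEquivariantGraded k G) : G →* Module.End k (⨁ g, M.fiber g) where
  toFun := M.actionMap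
  map_one' := by
    classical
    apply DirectSum.linearMap_ext
    intro g
    apply LinearMap.ext
    intro m
    have e : 1 * g * 1⁻¹ = g := by simp
    simp only [LinearMap.comp_apply, M.actionMap_lof 1 e, M.act_one e, Module.End.one_apply]
  map_mul' x y := by
    classical
    apply DirectSum.linearMap_ext
    intro g
    apply LinearMap.ext
    intro m
    have e : x * (y * g * y⁻¹) * x⁻¹ = x * y * g * (x * y)⁻¹ := by group
    simp only [LinearMap.comp_apply, Module.End.mul_apply, M.actionMap_lof (x * y) rfl,
      M.actionMap_lof y rfl, M.actionMap_lof x e, M.act_mul x y rfl e rfl]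

/-- The stable anti-Yetter-Drinfeld `kG`-module `Γ_c(G, M) = ⨁ g, M_g` of compactly supported
sections, with coaction given by the grading and action by the equivariant structure. -/
def gammaC (M : StableEquivariantGraded k G) : SAYDModule k (MonoidAlgebra k G) where
  carrier := ⨁ g, M.fiber g
  coact := M.coact
  coassoc := by
    classical
    apply DirectSum.linearMap_ext
    intro g
    apply LinearMap.ext
    intro m
    simp [coact_lof]
  counital := by
    classical
    apply DirectSum.linearMap_ext
    intro g
    apply LinearMap.ext
    intro m
    simp [coact_lof]
  act := MonoidAlgebra.lift k _ G M.rep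
  compat := by
    classical
    intro h m
    induction h using MonoidAlgebra.induction_linear with
    | zero => simp
    | add a b ha hb => simp only [map_add, LinearMap.add_apply, ha, hb]
    | single x r =>
      induction m using DirectSum.induction_on with
      | zero => simp
      | of g m =>
        change M.coact (MonoidAlgebra.lift k _ G M.rep (MonoidAlgebra.single x r)
            (DirectSum.lof k G M.fiber g m)) =
          aydMap (MonoidAlgebra.lift k _ G M.rep).toLinearMap _ (M.coact (DirectSum.lof k G M.fiber g m))
        have hx : (MonoidAlgebra.single x r : MonoidAlgebra k G) =
            r • MonoidAlgebra.of k G x := by simp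
        have hc : Coalgebra.comul (R := k) (MonoidAlgebra.of k G x) =
            MonoidAlgebra.of k G x ⊗ₜ[k] MonoidAlgebra.of k G x := by
          simp
        have hs : HopfAlgebra.antipode k (MonoidAlgebra.of k G x) = MonoidAlgebra.of k G x⁻¹ := by
          simp
        have ha (n : ⨁ g, M.fiber g) :
            MonoidAlgebra.lift k _ G M.rep (MonoidAlgebra.of k G x) n = M.actionMap x n := by
          rw [MonoidAlgebra.lift_of]
          rfl
        rw [hx, map_smul, map_smul, map_smul, map_smul, LinearMap.smul_apply, LinearMap.smul_apply,
          map_smul, hc, LinearMap.lTensor_tmul, hc, coact_lof, aydMap_tmul, hs,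
          AlgHom.toLinearMap_apply, ha, M.actionMap_lof x rfl, coact_lof, map_mul, map_mul,
          mul_assoc (MonoidAlgebra.of k G x)]
      | add a b ha hb => simp only [map_add, ha, hb]
  stable := by
    classical
    intro m
    induction m using DirectSum.induction_on with
    | zero => simp
    | of g m =>
      change TensorProduct.lift _ (M.coact (DirectSum.lof k G M.fiber g m)) =
        DirectSum.lof k G M.fiber g m
      have e : g * g * g⁻¹ = g := by simp
      rw [coact_lof, TensorProduct.lift.tmul, LinearMap.flip_apply]
      simp only [AlgHom.toLinearMap_apply, MonoidAlgebra.lift_of]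
      change M.actionMap g _ = _
      rw [M.actionMap_lof g e, M.stable g e]
    | add a b ha hb => simp only [map_add, ha, hb]

/-- The functor `V ↦ ⨁ c, Hom(V, Γ_c(G, M_c))^G`, summed over the conjugacy classes of `G`. -/
abbrev classSum (M : ConjClasses G → StableEquivariantGraded k G) :
    (Comodule k (MonoidAlgebra k G))ᵒᵖ ⥤ ModuleCat.{u} k :=
  directSumFunctor k fun c => (M c).gammaC.homFunctor

open Classical in
/-- The subspace `k` of `k` if `g ∈ c`, and `0` otherwise. -/
def classFiber (k : Type u) [Field k] (c : ConjClasses G) (g : G) : Submodule k k :=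
  if g ∈ c.carrier then ⊤ else ⊥

theorem classFiber_conj (c : ConjClasses G) {x g h : G} (e : x * g * x⁻¹ = h) :
    classFiber k c g = classFiber k c h := by
  have : ConjClasses.mk g = ConjClasses.mk h :=
    ConjClasses.mk_eq_mk_iff_isConj.2 (isConj_iff.2 ⟨x, e⟩)
  have iff : g ∈ c.carrier ↔ h ∈ c.carrier := by
    rw [ConjClasses.mem_carrier_iff_mk_eq, ConjClasses.mem_carrier_iff_mk_eq, this]
  by_cases hg : g ∈ c.carrier
  · rw [classFiber, classFiber, if_pos hg, if_pos (iff.1 hg)]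
  · rw [classFiber, classFiber, if_neg hg, if_neg fun hh => hg (iff.2 hh)]

/-- The space `k` at each point of the conjugacy class `c`, zero elsewhere, with trivial
`G`-action. -/
def classFunctions (k : Type u) [Field k] (c : ConjClasses G) : StableEquivariantGraded k G where
  fiber g := classFiber k c g
  act _ _ _ e := Submodule.inclusion (classFiber_conj c e).le
  act_one _ _ := rfl
  act_mul _ _ _ _ _ _ _ _ _ := rfl
  stable _ _ _ := rfl

end

end StableEquivariantGraded

/-! A `kG`-comodule is a `G`-graded space, so identities between linear maps on tensor products can
be checked on homogeneous elements. There the twist reads `f ↦ (w ⊗ v ↦ x f(v ⊗ w))` with `x` the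
degree of `w`. The anti-Yetter-Drinfeld condition says that `x` sends degree `g` to degree `xgx⁻¹`.
Stability says that `x` fixes the elements of degree `x`. If `v` has degree `g`, then `f(v ⊗ w)` has
degree `gx`. Hence `x f(v ⊗ w)` has degree `x(gx)x⁻¹ = xg`, the degree of `w ⊗ v`, and twisting
twice acts by `gx` in degree `gx`, which is the identity. The hexagon is the associativity of the
action (`SAYDModule.contratrace`).

The axioms of a symmetric 2-contratrace pass to direct sums because they can be tested on
components. Left exactness passes because a finite limit involves only finitely many objects, so a
compatible family of finitely supported elements has a finite common support
(`directSumFunctor_preservesFiniteLimits`).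

Representability fails by Yoneda. A representing object would give a universal element, which lies
in a direct sum and so has finite support. Every value of the functor would then be concentrated on
those finitely many summands (`exists_finset_of_isRepresentable_directSumFunctor`). But each summand
is nonzero: a nonzero vector of `M_g` is a nonzero morphism from the line in degree `g`. With
infinitely many conjugacy classes this is a contradiction. -/

/-! ## Homogeneous elements of comodules over a group algebra -/

namespace Comodule

noncomputable section

section Coeff

variable {k G : Type u} [Field k]

/-- The coefficient of `g` in an element of `V ⊗ kG`. -/
def coeffRight (V : Type u) [AddCommGroup V] [Module k V] (g : G) :
    V ⊗[k] MonoidAlgebra k G →ₗ[k] V :=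
  (TensorProduct.rid k V).toLinearMap ∘ₗ
    (Finsupp.lapply g ∘ₗ (MonoidAlgebra.coeffLinearEquiv k).toLinearMap).lTensor V

theorem coeffRight_tmul (V : Type u) [AddCommGroup V] [Module k V] (g : G) (v : V)
    (a : MonoidAlgebra k G) : coeffRight V g (v ⊗ₜ a) = a.coeff g • v := by
  simp [coeffRight]

end Coeff

variable {k G : Type u} [Field k] [Group G]

/-- An element `v` of a `kG`-comodule is homogeneous of degree `g` if `v₀ ⊗ v₁ = v ⊗ g`. -/
def IsHomogeneousOfDegree (V : Comodule k (MonoidAlgebra k G)) (g : G) (v : V.carrier) : Prop :=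
  V.coact v = v ⊗ₜ MonoidAlgebra.of k G g

/-- Take the coefficient of `g` in the last leg of the coassociativity identity. The side `(ρ ⊗
id)ρ(v)` gives the coaction of the `g`-component (`h₁`). The side `(id ⊗ Δ)ρ(v)` gives that
component tensored with `g`, because group elements are group-like (`h₂`). -/
theorem isHomogeneousOfDegree_coeffRight (V : Comodule k (MonoidAlgebra k G)) (g : G)
    (v : V.carrier) : V.IsHomogeneousOfDegree g (coeffRight V.carrier g (V.coact v)) := by
  have h₁ (t : V.carrier ⊗[k] MonoidAlgebra k G) :
      (coeffRight (MonoidAlgebra k G) g).lTensor V.carrier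
        (TensorProduct.assoc k _ _ _ (V.coact.rTensor _ t)) =
          V.coact (coeffRight V.carrier g t) := by
    induction t with
    | zero => simp
    | add x y hx hy => simp only [map_add, hx, hy]
    | tmul w a =>
      rw [LinearMap.rTensor_tmul, coeffRight_tmul, map_smul]
      induction V.coact w with
      | zero => simp
      | add x y hx hy => simp only [TensorProduct.add_tmul, map_add, hx, hy, smul_add]
      | tmul x b => simp [coeffRight_tmul]
  have h₂ (t : V.carrier ⊗[k] MonoidAlgebra k G) :
      (coeffRight (MonoidAlgebra k G) g).lTensor V.carrier
        ((Coalgebra.comul (R := k) (A := MonoidAlgebra k G)).lTensor V.carrier t) =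
          coeffRight V.carrier g t ⊗ₜ MonoidAlgebra.of k G g := by
    classical
    induction t with
    | zero => simp
    | add x y hx hy => simp only [map_add, hx, hy, TensorProduct.add_tmul]
    | tmul w a =>
      induction a using MonoidAlgebra.induction_linear with
      | zero => simp
      | add a b ha hb => simp only [TensorProduct.tmul_add, map_add, ha, hb, TensorProduct.add_tmul]
      | single x r =>
        by_cases hx : x = g
        · subst hx
          simp [coeffRight_tmul, TensorProduct.smul_tmul]
        · simp [coeffRight_tmul, hx]
  rw [IsHomogeneousOfDegree, ← h₁, coassoc_apply, h₂]

/-- A comodule over a group algebra is spanned by its homogeneous elements. -/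
theorem span_isHomogeneousOfDegree (V : Comodule k (MonoidAlgebra k G)) :
    Submodule.span k {v | ∃ g, V.IsHomogeneousOfDegree g v} = ⊤ := by
  classical
  rw [eq_top_iff]
  intro v _
  -- The counit is `1` on every group element, so applying it sums the coefficients. Allowing every
  -- finite set larger than `s` lets the induction pass to sums by taking unions.
  have key (t : V.carrier ⊗[k] MonoidAlgebra k G) : ∃ s : Finset G, ∀ s', s ⊆ s' →
      TensorProduct.rid k V.carrier
        ((Coalgebra.counit (R := k) (A := MonoidAlgebra k G)).lTensor V.carrier t) =
          ∑ g ∈ s', coeffRight V.carrier g t := by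
    induction t with
    | zero => exact ⟨∅, by simp⟩
    | add x y hx hy =>
      obtain ⟨s, hs⟩ := hx
      obtain ⟨t, ht⟩ := hy
      refine ⟨s ∪ t, fun s' h => ?_⟩
      simp only [map_add, hs s' (Finset.union_subset_left h), ht s' (Finset.union_subset_right h),
        Finset.sum_add_distrib]
    | tmul w a =>
      induction a using MonoidAlgebra.induction_linear with
      | zero => exact ⟨∅, by simp⟩
      | add x y hx hy =>
        obtain ⟨s, hs⟩ := hx
        obtain ⟨t, ht⟩ := hy
        refine ⟨s ∪ t, fun s' h => ?_⟩
        simp only [TensorProduct.tmul_add, map_add, hs s' (Finset.union_subset_left h),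
          ht s' (Finset.union_subset_right h), Finset.sum_add_distrib]
      | single x r =>
        refine ⟨{x}, fun s' h => ?_⟩
        have hx : x ∈ s' := h (Finset.mem_singleton_self x)
        simp [coeffRight_tmul, Finsupp.single_apply, ite_smul, hx]
  obtain ⟨s, hs⟩ := key (V.coact v)
  -- By counitality `v` is the sum of its components.
  rw [← counital_apply V v, hs s subset_rfl]
  exact Submodule.sum_mem _ fun g _ =>
    Submodule.subset_span ⟨g, isHomogeneousOfDegree_coeffRight V g v⟩

/-- Linear maps that agree on homogeneous elements are equal. -/
theorem linearMap_ext_homogeneous {V : Comodule k (MonoidAlgebra k G)} {X : Type*}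
    [AddCommGroup X] [Module k X] {f f' : V.carrier →ₗ[k] X}
    (h : ∀ (g : G) (v : V.carrier), V.IsHomogeneousOfDegree g v → f v = f' v) : f = f' :=
  LinearMap.ext_on V.span_isHomogeneousOfDegree fun v ⟨g, hv⟩ => h g v hv

/-- Linear maps on `V ⊗ W` that agree on tensors of homogeneous elements are equal. -/
theorem tensor_ext_homogeneous {V W : Comodule k (MonoidAlgebra k G)} {X : Type u}
    [AddCommGroup X] [Module k X] {f f' : V.carrier ⊗[k] W.carrier →ₗ[k] X}
    (h : ∀ (g : G) (v : V.carrier) (x : G) (w : W.carrier), V.IsHomogeneousOfDegree g v →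
      W.IsHomogeneousOfDegree x w → f (v ⊗ₜ w) = f' (v ⊗ₜ w)) : f = f' :=
  TensorProduct.ext (linearMap_ext_homogeneous fun g v hv =>
    linearMap_ext_homogeneous fun x w hw => h g v x w hv hw)

theorem IsHomogeneousOfDegree.tmul {V W : Comodule k (MonoidAlgebra k G)} {g x : G}
    {v : V.carrier} {w : W.carrier} (hv : V.IsHomogeneousOfDegree g v)
    (hw : W.IsHomogeneousOfDegree x w) : (V ⊗ W).IsHomogeneousOfDegree (g * x) (v ⊗ₜ[k] w) := by
  change tensorCoact V W (v ⊗ₜ w) = _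
  rw [IsHomogeneousOfDegree] at hv hw
  rw [tensorCoact_tmul, hv, hw, mulMap_tmul, map_mul]
  rfl

theorem IsHomogeneousOfDegree.map {V W : Comodule k (MonoidAlgebra k G)} (f : V ⟶ W) {g : G}
    {v : V.carrier} (hv : V.IsHomogeneousOfDegree g v) :
    W.IsHomogeneousOfDegree g (lin f v) := by
  rw [IsHomogeneousOfDegree] at hv ⊢
  rw [← LinearMap.comp_apply, ← lin_comm f, LinearMap.comp_apply, hv, LinearMap.rTensor_tmul]

theorem isHomogeneousOfDegree_unit (r : k) :
    (𝟙_ (Comodule k (MonoidAlgebra k G))).IsHomogeneousOfDegree (1 : G) r := by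
  change r ⊗ₜ[k] (1 : MonoidAlgebra k G) = r ⊗ₜ MonoidAlgebra.of k G 1
  rw [map_one]

/-- The one-dimensional comodule `k` in degree `g`. -/
def gradedLine (k : Type u) [Field k] (g : G) : Comodule k (MonoidAlgebra k G) where
  carrier := k
  coact := (TensorProduct.mk k k (MonoidAlgebra k G)).flip (MonoidAlgebra.of k G g)
  coassoc := by ext; simp
  counital := by ext; simp

/-- A homogeneous element of degree `g`, as a morphism from the line in degree `g`. -/
def IsHomogeneousOfDegree.hom {V : Comodule k (MonoidAlgebra k G)} {g : G} {v : V.carrier}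
    (hv : V.IsHomogeneousOfDegree g v) : gradedLine k g ⟶ V :=
  mkHom (V := gradedLine k g) (LinearMap.toSpanSingleton k V.carrier v) (by
    rw [IsHomogeneousOfDegree] at hv
    apply LinearMap.ext_ring
    change (LinearMap.toSpanSingleton k V.carrier v).rTensor _ ((1 : k) ⊗ₜ _) =
      V.coact ((1 : k) • v)
    rw [LinearMap.rTensor_tmul, one_smul, hv]
    simp)

theorem IsHomogeneousOfDegree.lin_hom_one {V : Comodule k (MonoidAlgebra k G)} {g : G}
    {v : V.carrier} (hv : V.IsHomogeneousOfDegree g v) : lin hv.hom (1 : k) = v :=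
  one_smul k v

end

end Comodule

/-! ## The symmetric 2-contratrace represented by an saYD-module over a group algebra -/

namespace SAYDModule

noncomputable section

open Comodule

variable {k G : Type u} [Field k] [Group G] (N : SAYDModule k (MonoidAlgebra k G))

/-- For `x` group-like with `S(x) = x⁻¹`, the anti-Yetter-Drinfeld condition reduces to `ρ(xm) = xm
⊗ xgx⁻¹`. -/
theorem act_isHomogeneousOfDegree {g : G} {m : N.carrier}
    (hm : N.toComodule.IsHomogeneousOfDegree g m) (x : G) :
    N.toComodule.IsHomogeneousOfDegree (x * g * x⁻¹) (N.act (MonoidAlgebra.of k G x) m) := by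
  have hc : Coalgebra.comul (R := k) (MonoidAlgebra.of k G x) =
      MonoidAlgebra.of k G x ⊗ₜ[k] MonoidAlgebra.of k G x := by
    simp
  have hs : HopfAlgebra.antipode k (MonoidAlgebra.of k G x) = MonoidAlgebra.of k G x⁻¹ := by
    simp
  rw [IsHomogeneousOfDegree] at hm ⊢
  rw [N.compat, hm, hc, LinearMap.lTensor_tmul, hc, aydMap_tmul, hs, AlgHom.toLinearMap_apply,
    map_mul, map_mul, mul_assoc]

theorem act_eq_self {g : G} {m : N.carrier} (hm : N.toComodule.IsHomogeneousOfDegree g m) :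
    N.act (MonoidAlgebra.of k G g) m = m := by
  have h := N.stable m
  rw [IsHomogeneousOfDegree] at hm
  rw [hm, TensorProduct.lift.tmul] at h
  exact h

theorem act_of_mul (x y : G) (m : N.carrier) :
    N.act (MonoidAlgebra.of k G (x * y)) m =
      N.act (MonoidAlgebra.of k G x) (N.act (MonoidAlgebra.of k G y) m) := by
  rw [map_mul, map_mul, Module.End.mul_apply]

theorem act_of_one (m : N.carrier) : N.act (MonoidAlgebra.of k G 1) m = m := by
  rw [map_one, map_one, Module.End.one_apply]

/-- Here `w₀ ⊗ w₁ = w ⊗ x`, so the twist is the action of a single group element; all axioms are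
verified through this formula. -/
theorem twist_tmul {V W : Comodule k (MonoidAlgebra k G)}
    (f : V.carrier ⊗[k] W.carrier →ₗ[k] N.carrier) {x : G} {w : W.carrier}
    (hw : W.IsHomogeneousOfDegree x w) (v : V.carrier) :
    N.twist V W f (w ⊗ₜ v) = N.act (MonoidAlgebra.of k G x) (f (v ⊗ₜ w)) := by
  rw [IsHomogeneousOfDegree] at hw
  simp [twist, hw]

/-- The linear map `f ↦ (w ⊗ v ↦ w₁ f(v ⊗ w₀))` on morphisms of comodules. -/
def twistHom (V W : Comodule k (MonoidAlgebra k G)) :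
    (V ⊗ W ⟶ N.toComodule) →ₗ[k] (W ⊗ V ⟶ N.toComodule) where
  toFun f := mkHom (V := W ⊗ V) (W := N.toComodule) (N.twist V W (lin f)) <| by
    have h : (lin f).rTensor _ ∘ₗ (V ⊗ W).coact = N.coact ∘ₗ lin f := lin_comm f
    refine tensor_ext_homogeneous (V := W) (W := V) fun x w g v hw hv => ?_
    have hwv : (W ⊗ V).coact (w ⊗ₜ v) = _ := hw.tmul hv
    have hf := N.act_isHomogeneousOfDegree ((hv.tmul hw).map f) x
    rw [IsHomogeneousOfDegree] at hf
    change (N.twist V W (lin f)).rTensor _ ((W ⊗ V).coact (w ⊗ₜ v)) =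
      N.coact (N.twist V W (lin f) (w ⊗ₜ v))
    erw [hwv, LinearMap.rTensor_tmul, N.twist_tmul (lin f) hw v, hf]
    -- The degrees agree: `xg = x(gx)x⁻¹`.
    congr 2
    group
  map_add' f f' := by
    apply Comodule.hom_ext
    refine tensor_ext_homogeneous (V := W) (W := V) fun x w g v hw _ => ?_
    exact (N.twist_tmul _ hw v).trans ((map_add _ _ _).trans
      (congrArg₂ (· + ·) (N.twist_tmul _ hw v).symm (N.twist_tmul _ hw v).symm))
  map_smul' c f := by
    apply Comodule.hom_ext
    refine tensor_ext_homogeneous (V := W) (W := V) fun x w g v hw _ => ?_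
    exact (N.twist_tmul _ hw v).trans ((map_smul _ _ _).trans
      (congrArg (c • ·) (N.twist_tmul _ hw v).symm))

theorem lin_twistHom_tmul {V W : Comodule k (MonoidAlgebra k G)} (f : V ⊗ W ⟶ N.toComodule)
    {x : G} {w : W.carrier} (hw : W.IsHomogeneousOfDegree x w) (v : V.carrier) :
    lin (N.twistHom V W f) (w ⊗ₜ[k] v) =
      N.act (MonoidAlgebra.of k G x) (lin f (v ⊗ₜ[k] w)) :=
  N.twist_tmul (lin f) hw v

/-- For `v`, `w` of degrees `g`, `x`, the double twist multiplies `f(v ⊗ w)` by `gx`, which is its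
own degree, and stability applies. -/
theorem twistHom_twistHom (V W : Comodule k (MonoidAlgebra k G)) (f : V ⊗ W ⟶ N.toComodule) :
    N.twistHom W V (N.twistHom V W f) = f := by
  apply Comodule.hom_ext
  refine tensor_ext_homogeneous (V := V) (W := W) fun g v x w hv hw => ?_
  erw [lin_twistHom_tmul N _ hv w, lin_twistHom_tmul N f hw v, ← act_of_mul]
  exact N.act_eq_self ((hv.tmul hw).map f)

/-- The twist, as an isomorphism `Hom(V ⊗ W, N) ≅ Hom(W ⊗ V, N)`. -/
def twistIso (V W : Comodule k (MonoidAlgebra k G)) :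
    N.homFunctor.obj (op (V ⊗ W)) ≅ N.homFunctor.obj (op (W ⊗ V)) where
  hom := ModuleCat.ofHom (N.twistHom V W)
  inv := ModuleCat.ofHom (N.twistHom W V)
  hom_inv_id := ModuleCat.hom_ext (LinearMap.ext (N.twistHom_twistHom V W))
  inv_hom_id := ModuleCat.hom_ext (LinearMap.ext (N.twistHom_twistHom W V))

/-- The symmetric 2-contratrace `Hom(-, N)`. -/
def contratrace : SymmetricTwoContratrace k N.homFunctor where
  ι := N.twistIso
  natural {X X' Y Y'} f g := by
    apply ModuleCat.hom_ext
    apply LinearMap.ext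
    intro (p : X' ⊗ Y' ⟶ N.toComodule)
    apply Comodule.hom_ext
    refine tensor_ext_homogeneous (V := Y) (W := X) fun y w x v hw _ => ?_
    change lin (N.twistHom X Y ((f ⊗ₘ g) ≫ p)) (w ⊗ₜ[k] v) =
      lin (N.twistHom X' Y' p) (lin g w ⊗ₜ[k] lin f v)
    rw [lin_twistHom_tmul N _ hw, lin_twistHom_tmul N _ (hw.map g)]
    rfl
  hexagon T U V := by
    apply ModuleCat.hom_ext
    apply LinearMap.ext
    intro (p : T ⊗ (U ⊗ V) ⟶ N.toComodule)
    apply Comodule.hom_ext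
    change lin (N.twistHom T (U ⊗ V) p) = lin ((α_ U V T).hom ≫ N.twistHom (V ⊗ T) U
      ((α_ V T U).hom ≫ N.twistHom (T ⊗ U) V ((α_ T U V).hom ≫ p)))
    -- Only the factors that are moved to the front act, so `t` may remain arbitrary. The identity
    -- becomes `(xy)m = x(ym)`.
    refine TensorProduct.ext (tensor_ext_homogeneous (V := U) (W := V) fun x u y v hu hv => ?_)
    apply LinearMap.ext
    intro t
    change lin (N.twistHom T (U ⊗ V) p) ((u ⊗ₜ[k] v) ⊗ₜ[k] t) = lin (N.twistHom (V ⊗ T) U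
      ((α_ V T U).hom ≫ N.twistHom (T ⊗ U) V ((α_ T U V).hom ≫ p))) (u ⊗ₜ[k] (v ⊗ₜ[k] t))
    erw [lin_twistHom_tmul N _ (hu.tmul hv), lin_twistHom_tmul N _ hu, act_of_mul]
    exact congrArg _ (lin_twistHom_tmul N ((α_ T U V).hom ≫ p) hv (t ⊗ₜ[k] u)).symm
  unit X := by
    apply ModuleCat.hom_ext
    apply LinearMap.ext
    intro (p : X ⊗ 𝟙_ _ ⟶ N.toComodule)
    apply Comodule.hom_ext
    refine TensorProduct.ext' fun (r : k) x => ?_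
    change lin (N.twistHom X (𝟙_ _) p) (r ⊗ₜ[k] x) = lin p ((r • x) ⊗ₜ[k] (1 : k))
    -- Scalars have degree `1`, which acts trivially.
    erw [lin_twistHom_tmul N p (isHomogeneousOfDegree_unit r) x, act_of_one]
    refine congrArg (lin p) ?_
    change x ⊗ₜ[k] (r : k) = (r • x) ⊗ₜ[k] (1 : k)
    rw [TensorProduct.smul_tmul, smul_eq_mul, mul_one]
  stable X := by
    apply ModuleCat.hom_ext
    apply LinearMap.ext
    intro (p : 𝟙_ _ ⊗ X ⟶ N.toComodule)
    apply Comodule.hom_ext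
    refine tensor_ext_homogeneous (V := X) (W := 𝟙_ _) fun x v _ (r : k) hv _ => ?_
    change lin (N.twistHom (𝟙_ _) X p) (v ⊗ₜ[k] r) = lin p ((1 : k) ⊗ₜ[k] (r • v))
    -- Here `v` itself acts, through its degree `x`; since `p(r ⊗ v)` also has degree `x`, stability
    -- removes the action.
    have h := ((isHomogeneousOfDegree_unit r).tmul hv).map p
    rw [one_mul] at h
    erw [lin_twistHom_tmul N p hv, N.act_eq_self h]
    refine congrArg (lin p) ?_
    change (r : k) ⊗ₜ[k] v = (1 : k) ⊗ₜ[k] (r • v)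
    rw [← TensorProduct.smul_tmul, smul_eq_mul, mul_one]
  symmetric X Y := (N.twistIso X Y).hom_inv_id

theorem contratrace_isCanonicalSymmetry : N.IsCanonicalSymmetry N.contratrace :=
  fun _ _ _ => rfl

end

/-- The functor represented by an saYD-module is left exact. -/
instance {k H : Type u} [CommRing k] [Ring H] [HopfAlgebra k H] (M : SAYDModule k H) :
    Limits.PreservesFiniteLimits M.homFunctor := by
  have : Limits.PreservesFiniteLimits (M.homFunctor ⋙ forget (ModuleCat.{u} k)) :=
    inferInstanceAs (Limits.PreservesFiniteLimits (yoneda.obj M.toComodule))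
  exact Limits.preservesFiniteLimits_of_reflects_of_preserves _ (forget (ModuleCat.{u} k))

end SAYDModule

/-! ## Direct sums of functors -/

section DirectSumFunctor

variable {k : Type u} [CommRing k] {C : Type*} [Category.{u} C]
  {I : Type u} {F : I → Cᵒᵖ ⥤ ModuleCat.{u} k}

/-- Morphisms to a direct sum are determined by their components. -/
theorem directSumFunctor_hom_ext {A : ModuleCat.{u} k} {X : Cᵒᵖ}
    {f g : A ⟶ (directSumFunctor k F).obj X}
    (h : ∀ i, f ≫ (directSumProj k F i).app X = g ≫ (directSumProj k F i).app X) : f = g := by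
  apply ModuleCat.hom_ext
  apply LinearMap.ext
  intro t
  apply DFinsupp.ext
  intro i
  exact ConcreteCategory.congr_hom (h i) t

/-- The direct sum of isomorphisms. -/
noncomputable def directSumIso {X Y : Cᵒᵖ} (e : ∀ i, (F i).obj X ≅ (F i).obj Y) :
    (directSumFunctor k F).obj X ≅ (directSumFunctor k F).obj Y :=
  (DirectSum.congrLinearEquiv fun i => (e i).toLinearEquiv).toModuleIso

theorem directSumIso_hom_proj {X Y : Cᵒᵖ} (e : ∀ i, (F i).obj X ≅ (F i).obj Y) (i : I) :
    (directSumIso e).hom ≫ (directSumProj k F i).app Y =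
      (directSumProj k F i).app X ≫ (e i).hom := rfl

/-- The direct sum of symmetric 2-contratraces. -/
noncomputable def SymmetricTwoContratrace.directSum [MonoidalCategory C]
    (τ : ∀ i, SymmetricTwoContratrace k (F i)) :
    SymmetricTwoContratrace k (directSumFunctor k F) where
  ι X Y := directSumIso fun i => (τ i).ι X Y
  natural f g := directSumFunctor_hom_ext fun i => by
    rw [Category.assoc, directSumIso_hom_proj, ← Category.assoc, NatTrans.naturality,
      Category.assoc, (τ i).natural]
    rfl
  hexagon T U V := directSumFunctor_hom_ext fun i => by
    rw [directSumIso_hom_proj, (τ i).hexagon]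
    rfl
  unit X := directSumFunctor_hom_ext fun i => by
    rw [directSumIso_hom_proj, (τ i).unit]
    rfl
  stable X := directSumFunctor_hom_ext fun i => by
    rw [directSumIso_hom_proj, (τ i).stable]
    rfl
  symmetric X Y := directSumFunctor_hom_ext fun i => by
    rw [Category.assoc, directSumIso_hom_proj, ← Category.assoc, directSumIso_hom_proj,
      Category.assoc, (τ i).symmetric, Category.comp_id, Category.id_comp]

/-- A direct sum of left exact functors is left exact. -/
theorem directSumFunctor_preservesFiniteLimits [∀ i, Limits.PreservesFiniteLimits (F i)] :
    Limits.PreservesFiniteLimits (directSumFunctor k F) := by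
  classical
  suffices h : Limits.PreservesFiniteLimits
      (directSumFunctor k F ⋙ forget (ModuleCat.{u} k)) from
    Limits.preservesFiniteLimits_of_reflects_of_preserves _ (forget (ModuleCat.{u} k))
  -- In sets, being a limit means that each compatible family has a unique lift. Such lifts exist in
  -- every component; what remains is to assemble them into a finitely supported element.
  refine ⟨fun J _ _ => ⟨fun {K} => ⟨fun {c} hc => ?_⟩⟩⟩
  have hlim (i : I) := (Limits.Types.isLimit_iff _).1
    ⟨Limits.isLimitOfPreserves (F i ⋙ forget (ModuleCat.{u} k)) hc⟩
  refine (Limits.Types.isLimit_iff _).2 fun s hs => ?_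
  let t (j : J) : ⨁ i, (F i).obj (K.obj j) := s j
  have ht (i : I) : (fun j => t j i) ∈
      (K ⋙ F i ⋙ forget (ModuleCat.{u} k)).sections := fun {j j'} f =>
    congrArg (fun x : ⨁ i, (F i).obj (K.obj j') => x i) (hs f)
  choose x hx hx' using fun i => hlim i _ (ht i)
  -- Zero lifts the zero family, so uniqueness forces the lift to be zero.
  have hx₀ (i : I) (hi : ∀ j, t j i = 0) : x i = (0 : (F i).obj c.pt) :=
    (hx' i _ fun j => (map_zero ((F i).map (c.π.app j)).hom).trans (hi j).symm).symm
  -- Finiteness of `J` enters here: the union of the supports over all objects is finite.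
  let S : Finset I := Finset.univ.biUnion fun j => DFinsupp.support (t j)
  let y : ⨁ i, (F i).obj c.pt := DFinsupp.mk S fun i => x i
  have hy (i : I) : y i = x i := by
    by_cases hi : i ∈ S
    · exact DFinsupp.mk_of_mem hi
    · refine (DFinsupp.mk_of_notMem hi).trans (hx₀ i fun j => ?_).symm
      by_contra hj
      exact hi (Finset.mem_biUnion.2 ⟨j, Finset.mem_univ j, DFinsupp.mem_support_iff.2 hj⟩)
  refine ⟨y, fun j => ?_, fun z hz => ?_⟩
  · apply DFinsupp.ext
    intro i
    change ((F i).map (c.π.app j)).hom (y i) = t j i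
    rw [hy]
    exact hx i j
  · apply DFinsupp.ext
    intro i
    rw [hy]
    exact hx' i _ fun j => congrArg (fun x : ⨁ i, (F i).obj (K.obj j) => x i) (hz j)

/-- If a direct sum of functors is representable, all but finitely many summands are zero. -/
theorem exists_finset_of_isRepresentable_directSumFunctor
    (h : (directSumFunctor k F ⋙ forget (ModuleCat.{u} k)).IsRepresentable) :
    ∃ s : Finset I, ∀ i ∉ s, ∀ (X : C) (x : (F i).obj (op X)), x = 0 := by
  classical
  obtain ⟨Y, ⟨e⟩⟩ := h.has_representation
  -- The universal element: by Yoneda every element of the functor at `X` is the image of `η` under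
  -- some `f : X ⟶ Y`. Functoriality is componentwise, so no support can exceed that of `η`.
  let η : ⨁ i, (F i).obj (op Y) := e.homEquiv (𝟙 Y)
  refine ⟨DFinsupp.support η, fun i hi X x => ?_⟩
  let t : ⨁ i, (F i).obj (op X) := DirectSum.lof k I (fun i => (F i).obj (op X)) i x
  obtain ⟨f, hf⟩ := e.homEquiv.surjective
    (show (directSumFunctor k F ⋙ forget (ModuleCat.{u} k)).obj (op X) from t)
  have hη : η i = 0 := DFinsupp.notMem_support_iff.1 hi
  have hfη := hf.symm.trans (e.homEquiv_eq f)
  have hti : t i = ((F i).map f.op).hom (η i) :=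
    congrArg (fun y : ⨁ i, (F i).obj (op X) => y i) hfη
  rw [hη, map_zero] at hti
  exact (DirectSum.lof_apply (M := fun i => (F i).obj (op X)) k i x).symm.trans hti

end DirectSumFunctor

/-! ### Nonzero summands and the failure of representability -/

namespace StableEquivariantGraded

variable {k G : Type u} [Field k] [Group G]

open Classical in
theorem isHomogeneousOfDegree_lof (M : StableEquivariantGraded k G) (g : G)
    (m : M.fiber g) :
    M.gammaC.toComodule.IsHomogeneousOfDegree g (DirectSum.lof k G M.fiber g m) :=
  M.coact_lof g m

/-- Representability would make some summand vanish identically, since finitely many classes cannot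
exhaust `ConjClasses G`. A nonzero `m` in a fiber of that summand, viewed as a morphism from a
graded line, contradicts this. -/
theorem not_isRepresentable_classSum [Infinite (ConjClasses G)]
    (M : ConjClasses G → StableEquivariantGraded k G)
    (hM : ∀ c, (M c).support.Nonempty) :
    ¬ (classSum M ⋙ forget (ModuleCat.{u} k)).IsRepresentable := by
  classical
  intro h
  obtain ⟨s, hs⟩ := exists_finset_of_isRepresentable_directSumFunctor h
  obtain ⟨c, hc⟩ := Infinite.exists_notMem_finset s
  obtain ⟨g, hg⟩ := hM c
  have : Nontrivial ((M c).fiber g) := hg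
  obtain ⟨m, hm⟩ := exists_ne (0 : (M c).fiber g)
  have hom := (M c).isHomogeneousOfDegree_lof g m
  have h₀ : hom.hom = 0 := hs c hc (Comodule.gradedLine k g) hom.hom
  have h₁ : DirectSum.lof k G (M c).fiber g m = 0 := by
    rw [← hom.lin_hom_one, h₀]
    rfl
  apply hm
  rw [← DirectSum.lof_apply k g m, h₁]
  rfl

theorem support_classFunctions (c : ConjClasses G) :
    (classFunctions k c).support = c.carrier := by
  ext g
  change Nontrivial (classFiber k c g) ↔ g ∈ c.carrier
  rw [Submodule.nontrivial_iff_ne_bot, classFiber]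
  split_ifs with h <;> simp [h]

end StableEquivariantGraded

theorem mainTheorem11 {k G : Type u} [Field k] [Group G] [Infinite (ConjClasses G)] :
    (∀ M : ConjClasses G → StableEquivariantGraded k G,
      (∀ c, (M c).support = c.carrier) →
      ∃ τ : ∀ c, SymmetricTwoContratrace k (M c).gammaC.homFunctor,
        (∀ c, (M c).gammaC.IsCanonicalSymmetry (τ c)) ∧
        (∀ c, Limits.PreservesFiniteLimits (M c).gammaC.homFunctor) ∧
        ∃ σ : SymmetricTwoContratrace k (StableEquivariantGraded.classSum M),
          (∀ (V W : Comodule k (MonoidAlgebra k G)) (c : ConjClasses G),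
            (σ.ι V W).hom ≫ (directSumProj k (fun c => (M c).gammaC.homFunctor) c).app _ =
              (directSumProj k (fun c => (M c).gammaC.homFunctor) c).app _ ≫
                ((τ c).ι V W).hom) ∧
          Limits.PreservesFiniteLimits (StableEquivariantGraded.classSum M) ∧
          ¬ (StableEquivariantGraded.classSum M ⋙ forget (ModuleCat.{u} k)).IsRepresentable ∧
          ∀ N : SAYDModule k (MonoidAlgebra k G),
            IsEmpty (StableEquivariantGraded.classSum M ≅ N.homFunctor)) ∧
    ∀ c : ConjClasses G, (StableEquivariantGraded.classFunctions k c).support = c.carrier := by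
  refine ⟨fun M hM => ?_, StableEquivariantGraded.support_classFunctions⟩
  have hrep := StableEquivariantGraded.not_isRepresentable_classSum M fun c => by
    rw [hM]
    -- The support is a conjugacy class, which contains any of its representatives.
    exact c.exists_rep.imp fun g hg => ConjClasses.mem_carrier_iff_mk_eq.2 hg
  refine ⟨fun c => (M c).gammaC.contratrace,
    fun c => (M c).gammaC.contratrace_isCanonicalSymmetry, fun c => inferInstance,
    SymmetricTwoContratrace.directSum fun c => (M c).gammaC.contratrace,
    fun V W c => directSumIso_hom_proj _ c, directSumFunctor_preservesFiniteLimits, hrep,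
    fun N => ⟨fun e => hrep ?_⟩⟩
  -- After forgetting to sets, `N.homFunctor` is the Yoneda functor of the comodule underlying `N`,
  -- so `e` would yield a representation.
  exact Functor.IsRepresentable.mk' (X := N.toComodule)
    (Functor.isoWhiskerRight e (forget (ModuleCat.{u} k))).symm
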